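/- Let $n=2m$, let $k\ge 1$ be an integer with $\gcd(k,m)=1$, let $1\le\tau\le m$, let $u_1,\dots,u_\tau\in\mathbb F_{2^m}^{\times}\subset\mathbb F_{2^n}$, and let $F\in\mathbb F_2[X_1,\dots,X_\tau]$. Write $\mathrm{Tr}_1^d(y)=\sum_{j=0}^{d-1}y^{2^j}$ for $y\in\mathbb F_{2^d}$. For $f:\mathbb F_{2^n}\to\mathbb F_2$ let $\mathcal W_f(\beta)=\sum_{x\in\mathbb F_{2^n}}(-1)^{f(x)+\mathrm{Tr}_1^n(\beta x)}$; $f$ is bent if $|\mathcal W_f(\beta)|=2^m$ for all $\beta\in\mathbb F_{2^n}$, and its dual is then the function $\widetilde f:\mathbb F_{2^n}\to\mathbb F_2$ with $\mathcal W_f(\beta)=2^m(-1)^{\widetilde f(\beta)}$ for all $\beta$. Let $$g(x)=\mathrm{Tr}_1^m\big(x^{2^m+1}\big)+\mathrm{Tr}_1^n\Big(\sum_{i=1}^{2^{k-1}-1}x^{(2^m-1)i/2^k+1}\Big),\qquad x\in\mathbb F_{2^n},$$ where $1/2^k$ in an exponent is the inverse of $2^k$ modulo $2^n-1$ and exponents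 are represented by positive integers. Put $A(x)=1+x+x^{2^m}\in\mathbb F_{2^m}$, and for $a\in\mathbb F_{2^m}$ let $a^{1/(2^k-1)}=a^e$, where $e$ is a positive integer inverse of $2^k-1$ modulo $2^m-1$. Then: 1. $g$ is bent, and for every $\alpha\in\mathbb F_{2^n}$ with $\alpha+\alpha^{2^m}=1$ its dual is $$\widetilde g(x)=\mathrm{Tr}_1^m\Big(\big(\alpha A(x)+x^{2^m}+\alpha^{1/2^k}\big)A(x)^{1/(2^k-1)}\Big)$$ (here $\alpha^{1/2^k}=\alpha^{2^{n-k}}$ if $k\le n$). 2. The function $f(x)=g(x)+F\big(\mathrm{Tr}_1^n(u_1x),\dots,\mathrm{Tr}_1^n(u_\tau x)\big)$ is bent. 3. The dual of $f$ is $$\widetilde f(x)=\widetilde g(x)+F\Big(\mathrm{Tr}_1^m\big(u_1A(x)^{1/(2^k-1)}\big),\dots,\mathrm{Tr}_1^m\big(u_\tau A(x)^{1/(2^k-1)}\big)\Big).$$ -/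

import Mathlib

namespace NihoBent

/-- The absolute trace `Tr_1^d(x) = x + x^2 + x^(2^2) + ... + x^(2^(d-1))` of an element `x` of
the subfield `F_{2^d}` of `K` (that is, `x^(2^d) = x`). The sum lies in the prime field
`{0, 1}` of `K` (see `coe_tr`), which is identified with `ZMod 2`. -/
noncomputable def tr {K : Type*} [Field K] (d : ℕ) (x : K) : ZMod 2 :=
  open Classical in if ∑ i ∈ Finset.range d, x ^ (2 ^ i) = 0 then 0 else 1

/-- On the subfield `F_{2^d}`, the value `tr d x`, read in `K`, is the power sum. -/
theorem coe_tr {K : Type*} [Field K] [CharP K 2] (d : ℕ) (x : K) (hx : x ^ (2 ^ d) = x) :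
    (ZMod.cast (tr d x) : K) = ∑ i ∈ Finset.range d, x ^ (2 ^ i) := by
  have h : (∑ i ∈ Finset.range d, x ^ (2 ^ i)) ^ 2 = ∑ i ∈ Finset.range d, x ^ (2 ^ i) := by
    rw [sum_pow_char]
    have h1 := Finset.sum_range_succ (fun i => x ^ (2 ^ i)) d
    have h2 := Finset.sum_range_succ' (fun i => x ^ (2 ^ i)) d
    rw [h1] at h2
    simp only [pow_zero, pow_one, hx] at h2
    rw [add_right_cancel h2]
    exact Finset.sum_congr rfl fun i _ => by rw [← pow_mul, pow_succ]
  unfold tr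
  split_ifs with h0
  · simp [h0]
  · have : ∑ i ∈ Finset.range d, x ^ (2 ^ i) = 1 := by
      have h3 : (∑ i ∈ Finset.range d, x ^ (2 ^ i)) * (∑ i ∈ Finset.range d, x ^ (2 ^ i))
          = (∑ i ∈ Finset.range d, x ^ (2 ^ i)) * 1 := by rw [← sq, h, mul_one]
      exact mul_left_cancel₀ h0 h3
    rw [this]
    exact ZMod.cast_one (dvd_refl 2)

/-- The sign `(-1)^b` of a bit. -/
def sgn (b : ZMod 2) : ℤ := (-1) ^ b.val

/-- The Walsh transform `W_f(β) = ∑_x (-1)^(f(x) + Tr_1^n(βx))` of a Boolean function on a field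
with `2^n` elements. -/
noncomputable def walsh {K : Type*} [Field K] [Fintype K] (n : ℕ) (f : K → ZMod 2) (β : K) : ℤ :=
  ∑ x : K, sgn (f x + tr n (β * x))

/-- A Boolean function on a field with `2^(2m)` elements is bent if `|W_f(β)| = 2^m`
for all `β`. -/
def IsBent {K : Type*} [Field K] [Fintype K] (m : ℕ) (f : K → ZMod 2) : Prop :=
  ∀ β : K, |walsh (2 * m) f β| = 2 ^ m

/-- `f'` is the dual of the Boolean function `f` on a field with `2^(2m)` elements:
`W_f(β) = 2^m (-1)^(f'(β))` for all `β`. -/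
def IsDual {K : Type*} [Field K] [Fintype K] (m : ℕ) (f f' : K → ZMod 2) : Prop :=
  ∀ β : K, walsh (2 * m) f β = 2 ^ m * sgn (f' β)

/-- The exponent `1/a` modulo `N`: the least positive `e` with `a * e ≡ 1` modulo `N`
(it exists when `a` is coprime to `N > 0`). Positivity makes `0` raised to it equal to `0`. -/
noncomputable def invExp (a N : ℕ) : ℕ := sInf {e : ℕ | 0 < e ∧ a * e ≡ 1 [MOD N]}

theorem invExp_spec {a N : ℕ} (hN : 0 < N) (h : a.Coprime N) :
    0 < invExp a N ∧ a * invExp a N ≡ 1 [MOD N] := by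
  have hne : {e : ℕ | 0 < e ∧ a * e ≡ 1 [MOD N]}.Nonempty := by
    rcases Nat.lt_or_ge 1 N with h1 | h1
    · obtain ⟨e, -, he⟩ := Nat.exists_mul_mod_eq_one_of_coprime h h1
      refine ⟨e, Nat.pos_of_ne_zero ?_, ?_⟩
      · rintro rfl
        simp at he
      · rw [Nat.ModEq, he, Nat.mod_eq_of_lt h1]
    · obtain rfl : N = 1 := by omega
      exact ⟨1, one_pos, Nat.modEq_one⟩
  exact Nat.sInf_mem hne

/-- The Leander-Kholosha function
`g(x) = Tr_1^m(x^(2^m+1)) + Tr_1^n(∑_{i=1}^{2^(k-1)-1} x^((2^m-1) i/2^k + 1))`, `n = 2m`,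
where `1/2^k` is the inverse of `2^k` modulo `2^n - 1`. -/
noncomputable def lk {K : Type*} [Field K] (m k : ℕ) (x : K) : ZMod 2 :=
  tr m (x ^ (2 ^ m + 1)) +
    tr (2 * m) (∑ i ∈ Finset.Icc 1 (2 ^ (k - 1) - 1),
      x ^ ((2 ^ m - 1) * (i * invExp (2 ^ k) (2 ^ (2 * m) - 1)) + 1))

/-- `A^(1/(2^k-1))` where `A = 1 + x + x^(2^m)` lies in `F_{2^m}`, the exponent being an inverse
modulo `2^m - 1`. -/
noncomputable def rootA {K : Type*} [Field K] (m k : ℕ) (x : K) : K :=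
  (1 + x + x ^ (2 ^ m)) ^ invExp (2 ^ k - 1) (2 ^ m - 1)

/-- `Tr_1^m((α A + x^(2^m) + α^(1/2^k)) A^(1/(2^k-1)))`, `A = 1 + x + x^(2^m)`. The exponent
`1/2^k` modulo `2^n - 1`, `n = 2m`, is `2^(n-k)` when `k ≤ n`. -/
noncomputable def lkDual {K : Type*} [Field K] (m k : ℕ) (α x : K) : ZMod 2 :=
  tr m ((α * (1 + x + x ^ (2 ^ m)) + x ^ (2 ^ m) + α ^ invExp (2 ^ k) (2 ^ (2 * m) - 1))
    * rootA m k x)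

end NihoBent

namespace NihoBent

/-! ### Signs of bits. -/

section Sgn

/-! Write x̄ = x^(2^m) and T(x) = x + x̄. Frobenius invariance of the trace turns `lk` into Tr_1^m
of `nihoForm`, which is homogeneous of degree 2^k over F_{2^m} and equals y^(2^k) + y when T(y) = 1.
Fix α with T(α) = 1 and write x = a + bα with a, b in F_{2^m}, so T(x) = b. On each fibre of T the
Walsh phase at β is affine (`lk_add_tr_line`, `lk_add_tr_fixed`), so its sum is 0 or ±2^m
(`sum_sgn_tr_mul`). With A = 1 + T(β), the fibre b ≠ 0 survives iff bA + b^(2^k) = 0, i.e. b =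
A^(1/(2^k-1)); the fibre b = 0 survives iff A = 0. Exactly one fibre survives, and its constant
phase is the dual. Since each u_i lies in F_{2^m}, the F-term depends only on T(x); it is constant
on fibres and contributes its value at the surviving b. -/

theorem sgn_add (a b : ZMod 2) : sgn (a + b) = sgn a * sgn b := by
  revert a b; decide

theorem sgn_zero : sgn 0 = 1 := rfl

theorem sgn_one : sgn 1 = -1 := rfl

theorem sgn_injective : Function.Injective sgn := by
  intro a b; revert a b; decide

theorem abs_sgn (a : ZMod 2) : |sgn a| = 1 := by
  revert a; decide

end Sgn

/-! ### Inverse exponents. -/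

section Exponent

theorem pow_eq_self_of_modEq {K : Type*} [Field K] {x : K} {N e : ℕ} (hx : x ^ (N + 1) = x)
    (he : 0 < e) (h : e ≡ 1 [MOD N]) : x ^ e = x := by
  rcases eq_or_ne x 0 with rfl | h0
  · exact zero_pow he.ne'
  have h1 : x ^ N = 1 := by
    rw [pow_succ] at hx
    exact mul_right_cancel₀ h0 (hx.trans (one_mul x).symm)
  obtain ⟨c, hc⟩ := (Nat.modEq_iff_dvd' he).1 h.symm
  obtain rfl : e = N * c + 1 := by omega
  rw [pow_succ, pow_mul, h1, one_pow, one_mul]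

theorem pow_mul_invExp {K : Type*} [Field K] {x : K} {a N : ℕ} (ha : 0 < a) (hN : 0 < N)
    (h : a.Coprime N) (hx : x ^ (N + 1) = x) : x ^ (a * invExp a N) = x :=
  pow_eq_self_of_modEq hx (Nat.mul_pos ha (invExp_spec hN h).1) (invExp_spec hN h).2

theorem coprime_two_pow_two_pow_sub_one (k n : ℕ) (hn : 0 < n) :
    Nat.Coprime (2 ^ k) (2 ^ n - 1) := by
  apply Nat.Coprime.pow_left
  rw [Nat.coprime_two_left]
  obtain ⟨n, rfl⟩ : ∃ j, n = j + 1 := ⟨n - 1, by omega⟩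
  have := Nat.one_le_two_pow (n := n)
  exact ⟨2 ^ n - 1, by rw [pow_succ]; omega⟩

theorem coprime_two_pow_sub_one {k m : ℕ} (h : Nat.Coprime k m) :
    Nat.Coprime (2 ^ k - 1) (2 ^ m - 1) := by
  rw [Nat.Coprime, Nat.pow_sub_one_gcd_pow_sub_one, Nat.Coprime.gcd_eq_one h, pow_one]

end Exponent

/-! ### Additivity, Frobenius invariance and transitivity of the trace. -/

section Trace

theorem tr_zero {K : Type*} [Field K] (d : ℕ) : tr d (0 : K) = 0 := by
  simp [tr]

variable {K : Type*} [Field K] [CharP K 2]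

theorem zmod_cast_injective : Function.Injective (ZMod.cast : ZMod 2 → K) :=
  (ZMod.castHom (dvd_refl 2) K).injective

theorem zmod_cast_add (a b : ZMod 2) : (ZMod.cast (a + b) : K) = ZMod.cast a + ZMod.cast b :=
  map_add (ZMod.castHom (dvd_refl 2) K) a b

theorem tr_add {d : ℕ} {x y : K} (hx : x ^ 2 ^ d = x) (hy : y ^ 2 ^ d = y) :
    tr d (x + y) = tr d x + tr d y := by
  apply zmod_cast_injective (K := K)
  rw [zmod_cast_add, coe_tr d _ hx, coe_tr d _ hy, coe_tr d _ (by rw [add_pow_char_pow, hx, hy]),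
    ← Finset.sum_add_distrib]
  exact Finset.sum_congr rfl fun i _ => add_pow_char_pow x y 2 i

theorem tr_pow_two {d : ℕ} {x : K} (hx : x ^ 2 ^ d = x) : tr d (x ^ 2) = tr d x := by
  apply zmod_cast_injective (K := K)
  rw [coe_tr d _ hx, coe_tr d _ (by rw [pow_right_comm, hx])]
  have h1 := Finset.sum_range_succ (fun i => x ^ (2 ^ i)) d
  have h2 := Finset.sum_range_succ' (fun i => x ^ (2 ^ i)) d
  rw [h1] at h2
  simp only [pow_zero, pow_one, hx] at h2
  rw [add_right_cancel h2]
  exact Finset.sum_congr rfl fun i _ => by rw [← pow_mul, pow_succ']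

theorem tr_pow_two_pow {d : ℕ} {x : K} (hx : x ^ 2 ^ d = x) (j : ℕ) :
    tr d (x ^ 2 ^ j) = tr d x := by
  induction j with
  | zero => simp
  | succ j ih => rw [pow_succ, pow_mul, tr_pow_two (by rw [pow_right_comm, hx]), ih]

theorem relTrace_pow {m : ℕ} {x : K} (hx : x ^ 2 ^ (2 * m) = x) :
    (x + x ^ 2 ^ m) ^ 2 ^ m = x + x ^ 2 ^ m := by
  rw [add_pow_char_pow, ← pow_mul, ← pow_add, ← two_mul, hx, add_comm]

theorem tr_two_mul {m : ℕ} {x : K} (hx : x ^ 2 ^ (2 * m) = x) :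
    tr (2 * m) x = tr m (x + x ^ 2 ^ m) := by
  apply zmod_cast_injective (K := K)
  rw [coe_tr _ _ hx, coe_tr _ _ (relTrace_pow hx), two_mul, Finset.sum_range_add,
    ← Finset.sum_add_distrib]
  exact Finset.sum_congr rfl fun i _ => by rw [add_pow_char_pow, ← pow_mul, ← pow_add]

end Trace

/-! ### The subfield F_{2^m} and orthogonality of its characters. -/

section FixedField

variable {K : Type*} [Field K] [CharP K 2]

/-- The subfield of the `x` with `x ^ (2 ^ m) = x`. -/
def fixedField (K : Type*) [Field K] [CharP K 2] (m : ℕ) : Subfield K :=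
  (iterateFrobenius K 2 m).eqLocusField (RingHom.id K)

theorem mem_fixedField {m : ℕ} {x : K} : x ∈ fixedField K m ↔ x ^ 2 ^ m = x := Iff.rfl

/-- The trace polynomial has degree below 2^m and coefficient 1 at X, so it cannot vanish on 2^m
points. -/
theorem exists_tr_ne_zero {m : ℕ} (hm : 1 ≤ m) [Fintype (fixedField K m)]
    (hS : Fintype.card (fixedField K m) = 2 ^ m) : ∃ z : fixedField K m, tr m (z : K) ≠ 0 := by
  by_contra! h
  have hp := Polynomial.eq_zero_of_natDegree_lt_card_of_eval_eq_zero
    (∑ i ∈ Finset.range m, (Polynomial.X : Polynomial K) ^ 2 ^ i)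
    (Subtype.val_injective (p := (· ∈ fixedField K m))) (fun z => by
      rw [Polynomial.eval_finsetSum]
      simp only [Polynomial.eval_pow, Polynomial.eval_X]
      rw [← coe_tr m _ z.2, h z, ZMod.cast_zero]) (by
      rw [hS]
      refine lt_of_le_of_lt (Polynomial.natDegree_sum_le_of_forall_le (n := 2 ^ (m - 1)) _ _ ?_)
        (Nat.pow_lt_pow_right one_lt_two (by omega))
      intro i hi
      rw [Polynomial.natDegree_X_pow]
      have := Finset.mem_range.1 hi
      exact Nat.pow_le_pow_right two_pos (by omega))
  have h1 := congrArg (fun p => Polynomial.coeff p 1) hp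
  simp only [Polynomial.finsetSum_coeff, Polynomial.coeff_X_pow, Polynomial.coeff_zero] at h1
  rw [Finset.sum_eq_single 0] at h1
  · simp at h1
  · intro i _ hi
    rw [if_neg]
    exact (Nat.one_lt_two_pow hi).ne
  · intro h0
    simp at h0
    omega

theorem sum_sgn_tr_mul [DecidableEq K] {m : ℕ} (hm : 1 ≤ m)
    [Fintype (fixedField K m)] (hS : Fintype.card (fixedField K m) = 2 ^ m) {a : K} (ha : a ∈ fixedField K m) :
    ∑ z : fixedField K m, sgn (tr m (a * z)) = if a = 0 then 2 ^ m else 0 := by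
  split_ifs with h
  · simp [h, tr_zero, sgn_zero, hS]
  obtain ⟨w, hw⟩ := exists_tr_ne_zero hm hS
  -- Translation by a⁻¹w, with tr w = 1, flips every sign, so the sum equals its own negative.
  have hshift := Equiv.sum_comp (Equiv.addRight ((⟨a, ha⟩ : fixedField K m)⁻¹ * w))
    (fun z : fixedField K m => sgn (tr m (a * z)))
  have hval : ∀ z : fixedField K m,
      sgn (tr m (a * ((Equiv.addRight ((⟨a, ha⟩ : fixedField K m)⁻¹ * w)) z : fixedField K m)))
        = - sgn (tr m (a * z)) := by
    intro z
    have : a * ((Equiv.addRight ((⟨a, ha⟩ : fixedField K m)⁻¹ * w)) z : fixedField K m)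
        = a * z + w := by
      simp [mul_add, h]
    have hw1 : tr m (w : K) = 1 := by
      revert hw; generalize tr m (w : K) = t; revert t; decide
    rw [this, tr_add (mul_mem ha z.2) w.2, sgn_add, hw1, sgn_one, mul_neg_one]
  simp only [hval, Finset.sum_neg_distrib] at hshift
  omega

end FixedField

/-! ### The Leander-Kholosha function as the trace of a homogeneous form. -/

section LeanderKholosha

variable {K : Type*} [Field K]

/-- The form `∑_{i=1}^{2^k-1} x^(2^k-i) (x^(2^m))^i`, whose trace is the Leander-Kholosha
function. -/
def nihoForm (m k : ℕ) (x : K) : K :=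
  ∑ i ∈ Finset.Ico 1 (2 ^ k), x ^ (2 ^ k - i) * (x ^ 2 ^ m) ^ i

theorem nihoForm_mul {m : ℕ} (k : ℕ) {b : K} (hb : b ^ 2 ^ m = b) (x : K) :
    nihoForm m k (b * x) = b ^ 2 ^ k * nihoForm m k x := by
  unfold nihoForm
  rw [Finset.mul_sum]
  refine Finset.sum_congr rfl fun i hi => ?_
  have hi' := (Finset.mem_Ico.1 hi).2
  have : b ^ 2 ^ k = b ^ (2 ^ k - i) * b ^ i := by rw [← pow_add]; congr 1; omega
  rw [this, mul_pow, mul_pow b x, hb, mul_pow]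
  ring

theorem sum_Ico_symm {M : Type*} [AddCommMonoid M] (g : ℕ → M) {n : ℕ} (hn : 1 ≤ n) :
    ∑ i ∈ Finset.Ico 1 (2 * n), g i
      = g n + ∑ i ∈ Finset.Ico 1 n, (g i + g (2 * n - i)) := by
  have hr := Finset.sum_Ico_reflect g 1 (show n ≤ 2 * n + 1 by omega)
  rw [Finset.sum_add_distrib, hr, ← Finset.sum_Ico_consecutive g hn (show n ≤ 2 * n by omega),
    Finset.sum_eq_sum_Ico_succ_bot (show n < 2 * n by omega)]
  rw [show 2 * n + 1 - n = n + 1 by omega, show 2 * n + 1 - 1 = 2 * n by omega]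
  abel

variable [CharP K 2]

/-- The full geometric sum times x̄ + x = 1 is x̄^(2^k) + x^(2^k) = 1. Multiplying by x and dropping
the i = 0 term x^(2^k) leaves the form. -/
theorem nihoForm_of_relTrace_eq_one {m k : ℕ} {x : K} (hx : x + x ^ 2 ^ m = 1) :
    nihoForm m k x = x ^ 2 ^ k + x := by
  have h := geom_sum₂_mul (x ^ 2 ^ m) x (2 ^ k)
  rw [CharTwo.sub_eq_add, CharTwo.sub_eq_add, add_comm _ x, hx, mul_one, add_comm,
    ← add_pow_char_pow, hx, one_pow, Finset.range_eq_Ico,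
    Finset.sum_eq_sum_Ico_succ_bot (Nat.two_pow_pos k)] at h
  have h2 : nihoForm m k x
      = x * ∑ i ∈ Finset.Ico (0 + 1) (2 ^ k), (x ^ 2 ^ m) ^ i * x ^ (2 ^ k - 1 - i) := by
    rw [Finset.mul_sum]
    refine Finset.sum_congr rfl fun i hi => ?_
    have hi' := (Finset.mem_Ico.1 hi).2
    rw [show 2 ^ k - i = 2 ^ k - 1 - i + 1 by omega, pow_succ]
    ring
  have h3 : x ^ 2 ^ k = x * x ^ (2 ^ k - 1) := by
    rw [← pow_succ']
    congr 1
    have := Nat.two_pow_pos k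
    omega
  rw [pow_zero, one_mul, Nat.sub_zero, add_comm, ← CharTwo.sub_eq_add, sub_eq_iff_eq_add] at h
  rw [h2, h, h3]
  ring

theorem nihoForm_of_pow_eq_self {m k : ℕ} (hk : 1 ≤ k) {x : K} (hx : x ^ 2 ^ m = x) :
    nihoForm m k x = x ^ 2 ^ k := by
  have : ∀ i ∈ Finset.Ico 1 (2 ^ k), x ^ (2 ^ k - i) * (x ^ 2 ^ m) ^ i = x ^ 2 ^ k := by
    intro i hi
    have hi' := (Finset.mem_Ico.1 hi).2
    rw [hx, ← pow_add]
    congr 1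
    omega
  rw [nihoForm, Finset.sum_congr rfl this, Finset.sum_const, Nat.card_Ico, nsmul_eq_mul,
    Nat.cast_sub Nat.one_le_two_pow, Nat.cast_pow, Nat.cast_two, CharTwo.two_eq_zero,
    zero_pow (by omega), Nat.cast_one, zero_sub, CharTwo.neg_eq, one_mul]

/-- Raising the second summand to the power 2^k clears the exponent 1/2^k, and raising the norm to
2^(k-1) makes it the middle term of the form. The relative trace pairs the terms i and 2^k - i. -/
theorem lk_eq_tr_nihoForm {m k : ℕ} (hm : 1 ≤ m) (hk : 1 ≤ k)
    (hK : ∀ x : K, x ^ 2 ^ (2 * m) = x) (x : K) : lk m k x = tr m (nihoForm m k x) := by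
  have hN : 0 < 2 ^ (2 * m) - 1 := by
    have := Nat.one_lt_two_pow (n := 2 * m) (by omega)
    omega
  have hqq : (x ^ 2 ^ m) ^ 2 ^ m = x := by rw [← pow_mul, ← pow_add, ← two_mul, hK]
  have hroot : x ^ (2 ^ k * invExp (2 ^ k) (2 ^ (2 * m) - 1)) = x :=
    pow_mul_invExp (Nat.two_pow_pos k) hN (coprime_two_pow_two_pow_sub_one k _ (by omega))
      (by rw [Nat.sub_add_cancel Nat.one_le_two_pow, hK])
  have hterm : ∀ i ∈ Finset.Ico 1 (2 ^ (k - 1)),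
      (x ^ ((2 ^ m - 1) * (i * invExp (2 ^ k) (2 ^ (2 * m) - 1)) + 1)) ^ 2 ^ k
        = x ^ (2 ^ k - i) * (x ^ 2 ^ m) ^ i := by
    intro i hi
    have hi' : i < 2 ^ k := (Finset.mem_Ico.1 hi).2.trans_le
      (Nat.pow_le_pow_right two_pos (by omega))
    rw [← pow_mul, add_mul, one_mul, pow_add,
      show (2 ^ m - 1) * (i * invExp (2 ^ k) (2 ^ (2 * m) - 1)) * 2 ^ k
        = (2 ^ k * invExp (2 ^ k) (2 ^ (2 * m) - 1)) * ((2 ^ m - 1) * i) by ring,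
      pow_mul, hroot, ← pow_mul, ← pow_add, ← pow_add]
    congr 1
    have h1 := Nat.one_le_two_pow (n := m)
    zify [h1, hi'.le]
    ring
  have hk2 : 2 ^ k = 2 * 2 ^ (k - 1) := by rw [← pow_succ']; congr 1; omega
  have hIcc : Finset.Icc 1 (2 ^ (k - 1) - 1) = Finset.Ico 1 (2 ^ (k - 1)) := by
    ext i
    have := Nat.two_pow_pos (k - 1)
    simp only [Finset.mem_Icc, Finset.mem_Ico]
    omega
  have hnorm : (x ^ (2 ^ m + 1)) ^ 2 ^ m = x ^ (2 ^ m + 1) := by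
    rw [pow_succ, mul_pow, hqq, mul_comm]
  unfold lk
  rw [tr_two_mul (hK _), ← tr_pow_two_pow hnorm (k - 1), ← tr_pow_two_pow (relTrace_pow (hK _)) k,
    ← tr_add (by rw [pow_right_comm, hnorm]) (by rw [pow_right_comm, relTrace_pow (hK _)]),
    add_pow_char_pow, pow_right_comm _ (2 ^ m) (2 ^ k), sum_pow_char_pow, hIcc,
    Finset.sum_congr rfl hterm, sum_pow_char_pow, ← Finset.sum_add_distrib, nihoForm]
  congr 1
  conv_rhs => rw [hk2, sum_Ico_symm _ Nat.one_le_two_pow, ← hk2]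
  congr 1
  · rw [hk2, show 2 * 2 ^ (k - 1) - 2 ^ (k - 1) = 2 ^ (k - 1) by omega, ← mul_pow, pow_succ,
      mul_comm]
  · refine Finset.sum_congr rfl fun i hi => ?_
    have hi' : i < 2 ^ k := (Finset.mem_Ico.1 hi).2.trans_le
      (Nat.pow_le_pow_right two_pos (by omega))
    rw [show 2 ^ k - (2 ^ k - i) = i by omega, mul_pow, ← pow_mul _ i, mul_comm i, pow_mul _ _ i,
      hqq, ← pow_mul x (2 ^ k - i), mul_comm (2 ^ k - i), pow_mul x]
    ring

end LeanderKholosha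

/-! ### Coordinates over F_{2^m} and elements of relative trace 1. -/

section Decomposition

variable {K : Type*} [Field K] [CharP K 2]

/-- If `α` has relative trace `1`, then `1, α` is a basis of `K` over the fixed field of
`x ↦ x ^ (2 ^ m)`. -/
theorem bijective_add_mul {m : ℕ} (hK : ∀ x : K, x ^ 2 ^ (2 * m) = x) {α : K}
    (hα : α + α ^ 2 ^ m = 1) :
    Function.Bijective fun p : fixedField K m × fixedField K m => (p.1 : K) + p.2 * α := by
  have key : ∀ a b : fixedField K m,
      ((a : K) + b * α) + ((a : K) + b * α) ^ 2 ^ m = b := by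
    intro a b
    have ha : (a : K) ^ 2 ^ m = a := a.2
    have hb : (b : K) ^ 2 ^ m = b := b.2
    rw [add_pow_char_pow, mul_pow, ha, hb]
    linear_combination (b : K) * hα + CharTwo.add_self_eq_zero (a : K)
  constructor
  · rintro ⟨a, b⟩ ⟨a', b'⟩ h
    simp only at h
    have hb : b = b' := by
      apply Subtype.ext
      rw [← key a b, ← key a' b', h]
    subst hb
    rw [add_left_inj] at h
    rw [Subtype.ext h]
  · intro x
    have hb := relTrace_pow (hK x)
    have ha : x + (x + x ^ 2 ^ m) * α ∈ fixedField K m := by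
      rw [mem_fixedField, add_pow_char_pow, mul_pow, hb]
      linear_combination (x + x ^ 2 ^ m) * hα - (x + x ^ 2 ^ m) * CharTwo.add_self_eq_zero α
        + CharTwo.add_self_eq_zero (x ^ 2 ^ m)
    refine ⟨(⟨_, ha⟩, ⟨_, hb⟩), ?_⟩
    simp only
    rw [add_assoc, CharTwo.add_self_eq_zero, add_zero]

theorem card_fixedField [Fintype K] {m : ℕ} [Fintype (fixedField K m)]
    (hK : Fintype.card K = 2 ^ (2 * m)) {α : K} (hα : α + α ^ 2 ^ m = 1) :
    Fintype.card (fixedField K m) = 2 ^ m := by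
  have h := Fintype.card_of_bijective (bijective_add_mul (fun x => hK ▸ FiniteField.pow_card x) hα)
  rw [Fintype.card_prod, hK, two_mul, pow_add] at h
  exact Nat.mul_self_inj.1 h

theorem exists_relTrace_eq_one [Fintype K] {m : ℕ} (hm : 1 ≤ m)
    (hK : Fintype.card K = 2 ^ (2 * m)) : ∃ α : K, α + α ^ 2 ^ m = 1 := by
  have hK' : ∀ x : K, x ^ 2 ^ (2 * m) = x := fun x => hK ▸ FiniteField.pow_card x
  obtain ⟨x, hx⟩ : ∃ x : K, x + x ^ 2 ^ m ≠ 0 := by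
    by_contra! h
    have hq : 1 < 2 ^ m := Nat.one_lt_two_pow (by omega)
    have hp := Polynomial.eq_zero_of_natDegree_lt_card_of_eval_eq_zero
      (Polynomial.X ^ 2 ^ m - Polynomial.X : Polynomial K) Function.injective_id (fun x => by
        simp only [Polynomial.eval_sub, Polynomial.eval_pow, Polynomial.eval_X, id]
        rw [CharTwo.sub_eq_add, add_comm, h]) (by
        rw [FiniteField.X_pow_card_sub_X_natDegree_eq K hq, hK]
        exact Nat.pow_lt_pow_right one_lt_two (by omega))
    exact FiniteField.X_pow_card_sub_X_ne_zero K hq hp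
  refine ⟨x * (x + x ^ 2 ^ m)⁻¹, ?_⟩
  rw [mul_pow, inv_pow, relTrace_pow (hK' x), ← add_mul, mul_inv_cancel₀ hx]

end Decomposition

/-! ### Walsh sums along the fibres of the relative trace. -/

section Walsh

variable {K : Type*} [Field K] [CharP K 2]

/-- Frobenius is injective, so α^e also has relative trace 1; hence α + α^e has relative trace 0. -/
theorem relTrace_root {m k e : ℕ} {α : K} (hα : α + α ^ 2 ^ m = 1)
    (he : α ^ (2 ^ k * e) = α) : (α + α ^ e) ^ 2 ^ m = α + α ^ e := by
  have h1 : α ^ e + (α ^ e) ^ 2 ^ m = 1 := by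
    apply (iterateFrobenius K 2 k).injective
    rw [map_one, iterateFrobenius_def, add_pow_char_pow, pow_right_comm _ (2 ^ m), ← pow_mul,
      mul_comm e, he, hα]
  rw [add_pow_char_pow]
  linear_combination hα + h1 - CharTwo.add_self_eq_zero α - CharTwo.add_self_eq_zero (α ^ e)
    + CharTwo.two_eq_zero (R := K)

/-- The phase of `lk m k + Tr(β ·)` on the line through `z + α` is affine in `z`. -/
theorem lk_add_tr_line {m k e : ℕ} (hm : 1 ≤ m) (hk : 1 ≤ k)
    (hK : ∀ x : K, x ^ 2 ^ (2 * m) = x) {α : K} (hα : α + α ^ 2 ^ m = 1)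
    (he : α ^ (2 ^ k * e) = α) (β : K) {b z : K} (hb : b ^ 2 ^ m = b) (hz : z ^ 2 ^ m = z) :
    lk m k (b * (z + α)) + tr (2 * m) (β * (b * (z + α)))
      = tr m ((α * (1 + β + β ^ 2 ^ m) + β ^ 2 ^ m + α ^ e) * b)
        + tr m ((b * (1 + β + β ^ 2 ^ m) + b ^ 2 ^ k) * z) := by
  have hαe := relTrace_root hα he
  have hmul : ∀ {x y : K}, x ^ 2 ^ m = x → y ^ 2 ^ m = y → (x * y) ^ 2 ^ m = x * y :=
    fun hx hy => by rw [mul_pow, hx, hy]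
  have hadd : ∀ {x y : K}, x ^ 2 ^ m = x → y ^ 2 ^ m = y → (x + y) ^ 2 ^ m = x + y :=
    fun hx hy => by rw [add_pow_char_pow, hx, hy]
  have hbk : (b ^ 2 ^ k) ^ 2 ^ m = b ^ 2 ^ k := by rw [pow_right_comm, hb]
  have hzk : (z ^ 2 ^ k) ^ 2 ^ m = z ^ 2 ^ k := by rw [pow_right_comm, hz]
  have hline : (z + α) + (z + α) ^ 2 ^ m = 1 := by
    rw [add_pow_char_pow, hz]
    linear_combination hα + CharTwo.add_self_eq_zero z
  -- Writing α = (α^e)^(2^k) makes the constant part a 2^k-th power, which the trace reduces to b(α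
  -- + α^e).
  have hform : nihoForm m k (b * (z + α))
      = ((b * z) ^ 2 ^ k + (b * (α + α ^ e)) ^ 2 ^ k) + b ^ 2 ^ k * z := by
    rw [nihoForm_mul k hb, nihoForm_of_relTrace_eq_one hline, add_pow_char_pow, mul_pow, mul_pow,
      add_pow_char_pow, ← pow_mul α e, mul_comm e, he]
    ring
  have hβ := relTrace_pow (hK β)
  have hβα := relTrace_pow (hK (β * α))
  have htrace : β * (b * (z + α)) + (β * (b * (z + α))) ^ 2 ^ m
      = b * (β * α + (β * α) ^ 2 ^ m) + b * (β + β ^ 2 ^ m) * z := by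
    rw [mul_pow, mul_pow b, hb, add_pow_char_pow, hz, mul_pow β]
    ring
  have hconst : (α * (1 + β + β ^ 2 ^ m) + β ^ 2 ^ m + α ^ e) * b
      = b * (α + α ^ e) + b * (β * α + (β * α) ^ 2 ^ m) := by
    rw [mul_pow]
    linear_combination -(b * β ^ 2 ^ m) * hα + b * β ^ 2 ^ m * CharTwo.add_self_eq_zero α
  have hlin : (b * (1 + β + β ^ 2 ^ m) + b ^ 2 ^ k) * z
      = (b * z + b * (β + β ^ 2 ^ m) * z) + b ^ 2 ^ k * z := by ring
  rw [lk_eq_tr_nihoForm hm hk hK, hform, tr_two_mul (hK _), htrace, hconst, hlin,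
    tr_add (hadd (by rw [pow_right_comm, hmul hb hz]) (by rw [pow_right_comm, hmul hb hαe]))
      (hmul hbk hz),
    tr_add (by rw [pow_right_comm, hmul hb hz]) (by rw [pow_right_comm, hmul hb hαe]),
    tr_pow_two_pow (hmul hb hz), tr_pow_two_pow (hmul hb hαe),
    tr_add (hmul hb hβα) (hmul (hmul hb hβ) hz), tr_add (hmul hb hαe) (hmul hb hβα),
    tr_add (hadd (hmul hb hz) (hmul (hmul hb hβ) hz)) (hmul hbk hz),
    tr_add (hmul hb hz) (hmul (hmul hb hβ) hz)]
  ring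

theorem lk_add_tr_fixed {m k : ℕ} (hm : 1 ≤ m) (hk : 1 ≤ k)
    (hK : ∀ x : K, x ^ 2 ^ (2 * m) = x) (β : K) {a : K} (ha : a ^ 2 ^ m = a) :
    lk m k a + tr (2 * m) (β * a) = tr m ((1 + β + β ^ 2 ^ m) * a) := by
  rw [lk_eq_tr_nihoForm hm hk hK, nihoForm_of_pow_eq_self hk ha, tr_pow_two_pow ha,
    tr_two_mul (hK _), ← tr_add ha (relTrace_pow (hK _)), mul_pow, ha]
  congr 1
  ring

theorem rootA_pow_eq {m k : ℕ} (hm : 1 ≤ m) (hk : 1 ≤ k) (hkm : Nat.Coprime k m)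
    (hK : ∀ x : K, x ^ 2 ^ (2 * m) = x) (β : K) :
    rootA m k β ^ (2 ^ k - 1) = 1 + β + β ^ 2 ^ m := by
  have h1 := Nat.one_lt_two_pow (n := m) (by omega)
  have h2 := Nat.one_lt_two_pow (n := k) (by omega)
  rw [rootA, ← pow_mul, mul_comm]
  refine pow_mul_invExp (by omega) (by omega) (coprime_two_pow_sub_one hkm) ?_
  rw [Nat.sub_add_cancel h1.le, add_assoc, add_pow_char_pow, one_pow, relTrace_pow (hK β)]

theorem rootA_pow {m k : ℕ} (hK : ∀ x : K, x ^ 2 ^ (2 * m) = x) (β : K) :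
    rootA m k β ^ 2 ^ m = rootA m k β := by
  rw [rootA, pow_right_comm, add_assoc, add_pow_char_pow, one_pow, relTrace_pow (hK β)]

theorem eq_rootA_iff {m k : ℕ} (hm : 1 ≤ m) (hk : 1 ≤ k) (hkm : Nat.Coprime k m)
    (hK : ∀ x : K, x ^ 2 ^ (2 * m) = x) (β : K) {b : K} (hb : b ^ 2 ^ m = b) (hb0 : b ≠ 0) :
    b * (1 + β + β ^ 2 ^ m) + b ^ 2 ^ k = 0 ↔ b = rootA m k β := by
  have h1 := Nat.one_lt_two_pow (n := m) (by omega)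
  have h2 := Nat.one_lt_two_pow (n := k) (by omega)
  have hb1 : b ^ 2 ^ k = b * b ^ (2 ^ k - 1) := by rw [← pow_succ']; congr 1; omega
  rw [hb1, ← mul_add, mul_eq_zero, or_iff_right hb0, ← CharTwo.sub_eq_add, sub_eq_zero]
  constructor
  · intro h
    rw [rootA, h, ← pow_mul]
    exact (pow_mul_invExp (by omega) (by omega) (coprime_two_pow_sub_one hkm)
      (by rw [Nat.sub_add_cancel h1.le, hb])).symm
  · rintro rfl
    exact (rootA_pow_eq hm hk hkm hK β).symm

/-- Adding any function of the relative trace `x + x ^ (2 ^ m)` to the Leander-Kholosha function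
keeps it bent and adds the same function of `rootA` to the dual. -/
theorem walsh_lk_add [Fintype K] {m k : ℕ} (hm : 1 ≤ m) (hk : 1 ≤ k) (hkm : Nat.Coprime k m)
    (hcard : Fintype.card K = 2 ^ (2 * m)) {α : K} (hα : α + α ^ 2 ^ m = 1)
    (P : K → ZMod 2) (β : K) :
    walsh (2 * m) (fun x => lk m k x + P (x + x ^ 2 ^ m)) β
      = 2 ^ m * sgn (lkDual m k α β + P (rootA m k β)) := by
  classical
  have hK : ∀ x : K, x ^ 2 ^ (2 * m) = x := fun x => hcard ▸ FiniteField.pow_card x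
  have hS := card_fixedField hcard hα
  have h1 := Nat.one_lt_two_pow (n := m) (by omega)
  have h2 := Nat.one_lt_two_pow (n := k) (by omega)
  have h3 := Nat.one_lt_two_pow (n := 2 * m) (by omega)
  have he : α ^ (2 ^ k * invExp (2 ^ k) (2 ^ (2 * m) - 1)) = α :=
    pow_mul_invExp (by omega) (by omega) (coprime_two_pow_two_pow_sub_one k _ (by omega))
      (by rw [Nat.sub_add_cancel h3.le, hK])
  have hA : 1 + β + β ^ 2 ^ m ∈ fixedField K m := by
    rw [add_assoc]
    exact add_mem (one_mem _) (relTrace_pow (hK β))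
  let r : fixedField K m := ⟨rootA m k β, rootA_pow hK β⟩
  have hinner : ∀ b : fixedField K m, ∑ a : fixedField K m,
      sgn (lk m k (a + b * α) + P ((a + b * α) + ((a : K) + b * α) ^ 2 ^ m)
        + tr (2 * m) (β * (a + b * α)))
      = if b = r then 2 ^ m * sgn (lkDual m k α β + P (rootA m k β)) else 0 := by
    intro b
    have hb : (b : K) ^ 2 ^ m = b := b.2
    -- The fibre b = 0 is F_{2^m} itself and cannot be rescaled to relative trace 1.
    by_cases hb0 : b = 0
    · subst hb0
      have hsum : ∀ a : fixedField K m,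
          sgn (lk m k (a + (0 : fixedField K m) * α)
            + P ((a + (0 : fixedField K m) * α) + ((a : K) + (0 : fixedField K m) * α) ^ 2 ^ m)
            + tr (2 * m) (β * (a + (0 : fixedField K m) * α)))
          = sgn (P 0) * sgn (tr m ((1 + β + β ^ 2 ^ m) * a)) := by
        intro a
        have ha : (a : K) ^ 2 ^ m = a := a.2
        rw [ZeroMemClass.coe_zero, zero_mul, add_zero, ha, CharTwo.add_self_eq_zero,
          add_right_comm, lk_add_tr_fixed hm hk hK β ha, sgn_add, mul_comm]
      rw [Finset.sum_congr rfl fun a _ => hsum a, ← Finset.mul_sum, sum_sgn_tr_mul hm hS hA]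
      have hiff : (0 : fixedField K m) = r ↔ 1 + β + β ^ 2 ^ m = 0 := by
        rw [← rootA_pow_eq hm hk hkm hK β, pow_eq_zero_iff (by omega), eq_comm,
          ← Subtype.coe_inj, ZeroMemClass.coe_zero]
      simp only [hiff]
      split_ifs with h
      · have hr : rootA m k β = 0 := by
          rw [← hiff, ← Subtype.coe_inj] at h
          exact h.symm
        rw [lkDual, hr, mul_zero, tr_zero, zero_add, mul_comm]
      · rw [mul_zero]
    -- Substituting a = bz puts the fibre in the form b(z + α).
    · rw [← Equiv.sum_comp (Equiv.mulLeft₀ b hb0)]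
      have hsum : ∀ z : fixedField K m,
          sgn (lk m k ((Equiv.mulLeft₀ b hb0 z : fixedField K m) + b * α)
            + P (((Equiv.mulLeft₀ b hb0 z : fixedField K m) + b * α)
              + (((Equiv.mulLeft₀ b hb0 z : fixedField K m) : K) + b * α) ^ 2 ^ m)
            + tr (2 * m) (β * ((Equiv.mulLeft₀ b hb0 z : fixedField K m) + b * α)))
          = sgn (tr m ((α * (1 + β + β ^ 2 ^ m) + β ^ 2 ^ m
              + α ^ invExp (2 ^ k) (2 ^ (2 * m) - 1)) * b) + P b)
            * sgn (tr m ((b * (1 + β + β ^ 2 ^ m) + b ^ 2 ^ k) * z)) := by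
        intro z
        have hz : (z : K) ^ 2 ^ m = z := z.2
        have hbz : ((Equiv.mulLeft₀ b hb0 z : fixedField K m) : K) + b * α = b * (z + α) := by
          rw [Equiv.mulLeft₀_apply, MulMemClass.coe_mul, mul_add]
        have hT : b * (z + α) + (b * (z + α)) ^ 2 ^ m = (b : K) := by
          rw [mul_pow, hb, add_pow_char_pow, hz]
          linear_combination (b : K) * hα + b * CharTwo.add_self_eq_zero (z : K)
        rw [hbz, hT, add_right_comm, lk_add_tr_line hm hk hK hα he β hb hz, ← sgn_add]
        congr 1
        ring
      rw [Finset.sum_congr rfl fun a _ => hsum a, ← Finset.mul_sum,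
        sum_sgn_tr_mul hm hS (add_mem (mul_mem b.2 hA) (pow_mem b.2 _))]
      have hiff : b = r ↔ b * (1 + β + β ^ 2 ^ m) + (b : K) ^ 2 ^ k = 0 := by
        rw [eq_rootA_iff hm hk hkm hK β hb (fun h => hb0 (Subtype.ext h)), ← Subtype.coe_inj]
      simp only [hiff]
      split_ifs with h
      · have hr : (b : K) = rootA m k β := congrArg Subtype.val (hiff.2 h)
        rw [lkDual, hr, mul_comm]
      · rw [mul_zero]
  unfold walsh
  rw [← (bijective_add_mul hK hα).sum_comp, Fintype.sum_prod_type_right]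
  simp only [hinner]
  simp

end Walsh

/-! ### Bentness and uniqueness of the dual, and the theorem. -/

theorem IsDual.isBent {K : Type*} [Field K] [Fintype K] {m : ℕ} {f f' : K → ZMod 2}
    (h : IsDual m f f') : IsBent m f := by
  intro β
  rw [h β, abs_mul, abs_sgn, mul_one, abs_pow, abs_two]

theorem IsDual.unique {K : Type*} [Field K] [Fintype K] {m : ℕ} {f f₁ f₂ : K → ZMod 2}
    (h₁ : IsDual m f f₁) (h₂ : IsDual m f f₂) : f₁ = f₂ := by
  funext β
  exact sgn_injective (mul_left_cancel₀ (pow_ne_zero m two_ne_zero) ((h₁ β).symm.trans (h₂ β)))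

end NihoBent

theorem theorem3p6 {K : Type*} [Field K] [Fintype K] (m k τ : ℕ)
    (hK : Fintype.card K = 2 ^ (2 * m)) (hk : 1 ≤ k) (hkm : Nat.Coprime k m)
    (hτ : 1 ≤ τ) (hτm : τ ≤ m)
    (u : Fin τ → K) (hu : ∀ i, u i ≠ 0 ∧ u i ^ (2 ^ m) = u i)
    (F : MvPolynomial (Fin τ) (ZMod 2)) :
    -- the Leander-Kholosha function is bent, with the explicit dual
    (NihoBent.IsBent m (fun x : K => NihoBent.lk m k x) ∧
      ∀ α : K, α + α ^ (2 ^ m) = 1 →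
        NihoBent.IsDual m (fun x : K => NihoBent.lk m k x) (NihoBent.lkDual m k α)) ∧
    -- the modified function is bent
    NihoBent.IsBent m (fun x : K => NihoBent.lk m k x +
      MvPolynomial.eval (fun i => NihoBent.tr (2 * m) (u i * x)) F) ∧
    -- its dual
    ∀ g' : K → ZMod 2, NihoBent.IsDual m (fun x : K => NihoBent.lk m k x) g' →
      NihoBent.IsDual m
        (fun x : K => NihoBent.lk m k x +
          MvPolynomial.eval (fun i => NihoBent.tr (2 * m) (u i * x)) F)
        (fun x : K => g' x +
          MvPolynomial.eval (fun i => NihoBent.tr m (u i * NihoBent.rootA m k x)) F) := by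
  have hm : 1 ≤ m := hτ.trans hτm
  have := charP_of_card_eq_prime_pow hK
  have hpow : ∀ x : K, x ^ 2 ^ (2 * m) = x := fun x => hK ▸ FiniteField.pow_card x
  have hg : ∀ α : K, α + α ^ (2 ^ m) = 1 →
      NihoBent.IsDual m (fun x : K => NihoBent.lk m k x) (NihoBent.lkDual m k α) := by
    intro α hα β
    have h := NihoBent.walsh_lk_add hm hk hkm hK hα (fun _ => 0) β
    simpa only [add_zero] using h
  have htr : ∀ (x : K) (i : Fin τ),
      NihoBent.tr (2 * m) (u i * x) = NihoBent.tr m (u i * (x + x ^ 2 ^ m)) := by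
    intro x i
    rw [NihoBent.tr_two_mul (hpow _), mul_pow, (hu i).2, mul_add]
  obtain ⟨α, hα⟩ := NihoBent.exists_relTrace_eq_one hm hK
  have hf : NihoBent.IsDual m
      (fun x : K => NihoBent.lk m k x +
        MvPolynomial.eval (fun i => NihoBent.tr (2 * m) (u i * x)) F)
      (fun x : K => NihoBent.lkDual m k α x +
        MvPolynomial.eval (fun i => NihoBent.tr m (u i * NihoBent.rootA m k x)) F) := by
    simp only [htr]
    exact fun β => NihoBent.walsh_lk_add hm hk hkm hK hα
      (fun y => MvPolynomial.eval (fun i => NihoBent.tr m (u i * y)) F) β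
  refine ⟨⟨(hg α hα).isBent, hg⟩, hf.isBent, fun g' hg' => ?_⟩
  -- By uniqueness, any dual of `lk` is the explicit one for the chosen α.
  rw [hg'.unique (hg α hα)]
  exact hf
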